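/- Let $G$ be a smooth $n$-dimensional real Lie group with Lie algebra $\mathfrak g=T_eG$ (the bracket being that of left-invariant vector fields), and let $e_1,\dots,e_n$ be a basis of $\mathfrak g$ with dual basis $e^1,\dots,e^n$. For $g\in G$ let $\mathrm{Ad}_g=(L_g)_*(R_{g^{-1}})_*$ on $\mathfrak g$. Matrices of operators on $\mathfrak g$ are taken in the basis $(e_i)$, the upper index being the row index: $\mathrm{Ad}_g e_i=\|\mathrm{Ad}_g\|^j_i\,e_j$ and $[e_k,e_i]=\|\mathrm{ad}\,e_k\|^j_i\,e_j$. Define on $G$ the invariant vector fields $$\xi_i(g)=(L_g)_*e_i,\qquad \eta_i(g)=-(R_g)_*e_i$$ and the invariant 1-forms $$\langle\omega^i(g),v\rangle=\langle e^i,(L_{g^{-1}})_*v\rangle,\qquad \langle\sigma^i(g),v\rangle=-\langle e^i,(R_{g^{-1}})_*v\rangle,\qquad v\in T_gG.$$ Then the 1-forms are the frames dual to the vector fields: $\langle\omega^i,\xi_j\rangle=\langle\sigma^i,\eta_j\rangle=\delta^i_j$ at every point of $G$. Let $\psi$ be any system of second canonical coordinates on $G$, that is, a diffeomorphism from an open neighbourhood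 $G_e$ of the identity onto an open neighbourhood $U$ of $0\in\mathbb R^n$ whose inverse is $$x=(x^1,\dots,x^n)\mapsto g_x=\exp(x^ne_n)\cdots\exp(x^1e_1),\qquad x\in U.$$ Write, in these coordinates, $\omega^i=\omega^i_k(x)\,dx^k$, $\sigma^i=\sigma^i_k(x)\,dx^k$, $\psi_*\xi_i=\xi^j_i(x)\,\partial_{x^j}$, $\psi_*\eta_i=\eta^j_i(x)\,\partial_{x^j}$. Then for all $x\in U$ and all $i$ $$\omega^i_1(x)=\delta^i_1,\qquad \omega^i_k(x)=\big\|\exp(-x^1\,\mathrm{ad}\,e_1)\exp(-x^2\,\mathrm{ad}\,e_2)\cdots\exp(-x^{k-1}\,\mathrm{ad}\,e_{k-1})\big\|^i_k\quad(1<k\le n).$$ Moreover, for all $x\in U$, $$\|\mathrm{Ad}_{g_x}\|=\big\|\exp(x^n\,\mathrm{ad}\,e_n)\cdots\exp(x^1\,\mathrm{ad}\,e_1)\big\|,\qquad \|\sigma(x)\|=-\|\mathrm{Ad}_{g_x}\|\cdot\|\omega(x)\|,$$ the matrices $\|\omega(x)\|$ and $\|\sigma(x)\|$ are invertible, and $$\|\xi(x)\|=\|\omega(x)\|^{-1},\qquad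 \|\eta(x)\|=\|\sigma(x)\|^{-1}.$$ -/

import Mathlib

open scoped Manifold ContDiff

noncomputable section

namespace LieGroupCoords

section Basics

variable {E : Type*} [NormedAddCommGroup E] [NormedSpace ℝ E]
  {G : Type*} [TopologicalSpace G] [ChartedSpace E G] [Group G] [LieGroup 𝓘(ℝ, E) ∞ G]

/-- A smooth real Lie group has the regularity under which Mathlib provides the Lie algebra
structure on its tangent space at the identity. -/
instance instLieGroupMinSmoothness : LieGroup 𝓘(ℝ, E) (minSmoothness ℝ 3) G := by
  rw [minSmoothness_of_isRCLikeNormedField]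
  infer_instance

/-! ### The exponential map -/

/-- Left-invariant vector fields are invariant under left translations. -/
theorem mfderiv_mulInvariantVectorField (X : GroupLieAlgebra 𝓘(ℝ, E) G) (g h : G) :
    mfderiv 𝓘(ℝ, E) 𝓘(ℝ, E) (fun b : G => g * b) h (mulInvariantVectorField X h)
      = mulInvariantVectorField X (g * h) := by
  have hd : ∀ a b : G, MDifferentiableAt 𝓘(ℝ, E) 𝓘(ℝ, E) (fun b : G => a * b) b := fun a b =>
    (contMDiff_mul_left (I := 𝓘(ℝ, E)) (n := ∞) (a := a)).mdifferentiable (by simp) b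
  have D : (fun x : G => g * h * x) = (fun b => g * b) ∘ (fun x => h * x) := by
    ext x; simp [mul_assoc]
  simp only [mulInvariantVectorField]
  have key := mfderiv_comp (I' := 𝓘(ℝ, E)) (1 : G) (hd g (h * 1)) (hd h 1)
  rw [← D, mul_one] at key
  rw [key]
  rfl

variable [FiniteDimensional ℝ E]

/-- Left-invariant vector fields are complete. -/
theorem exists_integralCurve (X : GroupLieAlgebra 𝓘(ℝ, E) G) :
    ∃ γ : ℝ → G, γ 0 = 1 ∧
      IsMIntegralCurve (I := 𝓘(ℝ, E)) γ (mulInvariantVectorField X) := by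
  have : IsTopologicalGroup G := topologicalGroup_of_lieGroup 𝓘(ℝ, E) ∞
  have : T1Space G := 𝓘(ℝ, E).t1Space G
  have : IsManifold 𝓘(ℝ, E) 1 G := IsManifold.of_le (n := ∞) (by simp)
  have hv := (contMDiff_mulInvariantVectorField (I := 𝓘(ℝ, E)) X).of_le
    (show (1 : ℕ∞ω) ≤ minSmoothness ℝ 2 by
      rw [minSmoothness_of_isRCLikeNormedField]; exact one_le_two)
  obtain ⟨γ, h0, hγ⟩ := exists_isMIntegralCurveAt_of_contMDiffAt_boundaryless
    (t₀ := 0) (hv.contMDiffAt (x := (1 : G)))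
  obtain ⟨ε, hε, hγ⟩ := isMIntegralCurveAt_iff'.1 hγ
  refine exists_isMIntegralCurve_of_isMIntegralCurveOn hv hε (fun g => ?_) 1
  refine ⟨fun t => g * γ t, by simp [h0], fun t ht => ?_⟩
  have ht' : t ∈ Metric.ball (0 : ℝ) ε := by
    rwa [Real.ball_eq_Ioo, zero_sub, zero_add]
  have h1 := (hγ t ht').hasMFDerivAt (Metric.isOpen_ball.mem_nhds ht')
  have hd : MDifferentiableAt 𝓘(ℝ, E) 𝓘(ℝ, E) (fun b : G => g * b) (γ t) :=
    (contMDiff_mul_left (I := 𝓘(ℝ, E)) (n := ∞) (a := g)).mdifferentiable (by simp) _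
  have h2 := (hd.hasMFDerivAt.comp t h1).hasMFDerivWithinAt (s := Set.Ioo (-ε) ε)
  have heq : (mfderiv 𝓘(ℝ, E) 𝓘(ℝ, E) (fun b : G => g * b) (γ t)).comp
      ((1 : ℝ →L[ℝ] ℝ).smulRight (mulInvariantVectorField X (γ t)))
      = (1 : ℝ →L[ℝ] ℝ).smulRight (mulInvariantVectorField X (g * γ t)) := by
    rw [← mfderiv_mulInvariantVectorField]
    apply ContinuousLinearMap.ext
    intro c
    exact map_smul (mfderiv 𝓘(ℝ, E) 𝓘(ℝ, E) (fun b : G => g * b) (γ t)) _ _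
  rw [← heq]
  exact h2

/-- The exponential map `exp : 𝔤 → G`: the time-one value of the integral curve through the
identity of the left-invariant vector field generated by `X`. -/
def lieExp (X : GroupLieAlgebra 𝓘(ℝ, E) G) : G :=
  (exists_integralCurve X).choose 1

/-! ### Adjoint representations -/

/-- The adjoint representation `Ad_g = (L_g)_* (R_{g⁻¹})_*`, the differential at the identity of
the inner automorphism `h ↦ g h g⁻¹`. -/
def Ad (g : G) : GroupLieAlgebra 𝓘(ℝ, E) G →ₗ[ℝ] GroupLieAlgebra 𝓘(ℝ, E) G :=
  (mfderiv 𝓘(ℝ, E) 𝓘(ℝ, E) (fun h : G => g * h * g⁻¹) 1 : E →L[ℝ] E).toLinearMap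

variable {n : ℕ} (e : Module.Basis (Fin n) ℝ (GroupLieAlgebra 𝓘(ℝ, E) G))

/-- The matrix `‖Ad_g‖`, with `Ad_g e_i = ‖Ad_g‖^j_i e_j` (upper index = row). -/
def AdMatrix (g : G) : Matrix (Fin n) (Fin n) ℝ :=
  LinearMap.toMatrix e e (Ad g)

/-- The matrix `‖ad e_k‖`, with `[e_k, e_i] = ‖ad e_k‖^j_i e_j` (upper index = row). -/
def adMatrix (k : Fin n) : Matrix (Fin n) (Fin n) ℝ :=
  LinearMap.toMatrix e e
    (LieAlgebra.ad ℝ (GroupLieAlgebra 𝓘(ℝ, E) G) (e k))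

/-! ### Invariant vector fields and 1-forms on the group -/

/-- The left-invariant vector field `ξ_i(g) = (L_g)_* e_i`. -/
def leftField (i : Fin n) (g : G) : TangentSpace 𝓘(ℝ, E) g :=
  mfderiv 𝓘(ℝ, E) 𝓘(ℝ, E) (fun h : G => g * h) 1 (e i)

/-- The right-invariant vector field `η_i(g) = -(R_g)_* e_i`. -/
def rightField (i : Fin n) (g : G) : TangentSpace 𝓘(ℝ, E) g :=
  -mfderiv 𝓘(ℝ, E) 𝓘(ℝ, E) (fun h : G => h * g) 1 (e i)

/-- The left-invariant 1-form `ω^i`: `⟨ω^i(g), v⟩ = e^i((L_{g⁻¹})_* v)`, where `e^i` is the basis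
of `𝔤*` dual to `e_i`. -/
def leftForm (i : Fin n) (g : G) : TangentSpace 𝓘(ℝ, E) g →ₗ[ℝ] ℝ :=
  e.coord i ∘ₗ
    (mfderiv 𝓘(ℝ, E) 𝓘(ℝ, E) (fun h : G => g⁻¹ * h) g : E →L[ℝ] E).toLinearMap

/-- The right-invariant 1-form `σ^i`, `⟨σ^i(g), v⟩ = -e^i((R_{g⁻¹})_* v)`. -/
def rightForm (i : Fin n) (g : G) : TangentSpace 𝓘(ℝ, E) g →ₗ[ℝ] ℝ :=
  -(e.coord i ∘ₗ
    (mfderiv 𝓘(ℝ, E) 𝓘(ℝ, E) (fun h : G => h * g⁻¹) g : E →L[ℝ] E).toLinearMap)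

/-! ### Components in local coordinates -/

/-- The coordinate tangent vector `∂_{x^k} g_x`, where `g_x = ψ⁻¹(x)`. -/
def coordVector (ψ : OpenPartialHomeomorph G (Fin n → ℝ)) (x : Fin n → ℝ) (k : Fin n) :
    TangentSpace 𝓘(ℝ, E) (ψ.symm x) :=
  mfderiv 𝓘(ℝ, Fin n → ℝ) 𝓘(ℝ, E) ψ.symm x (Pi.single k (1 : ℝ) : Fin n → ℝ)

/-- The matrix `‖ω(x)‖` of the components in `ω^i = ω^i_k(x) dx^k`. -/
def omega (ψ : OpenPartialHomeomorph G (Fin n → ℝ)) (x : Fin n → ℝ) :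
    Matrix (Fin n) (Fin n) ℝ :=
  Matrix.of fun i k => leftForm e i (ψ.symm x) (coordVector ψ x k)

/-- The matrix `‖σ(x)‖` of the components in `σ^i = σ^i_k(x) dx^k`. -/
def sigma (ψ : OpenPartialHomeomorph G (Fin n → ℝ)) (x : Fin n → ℝ) :
    Matrix (Fin n) (Fin n) ℝ :=
  Matrix.of fun i k => rightForm e i (ψ.symm x) (coordVector ψ x k)

/-- The matrix `‖ξ(x)‖` of the components in `ψ_* ξ_i = ξ^j_i(x) ∂_{x^j}` (row `j`, column `i`). -/
def xi (ψ : OpenPartialHomeomorph G (Fin n → ℝ)) (x : Fin n → ℝ) :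
    Matrix (Fin n) (Fin n) ℝ :=
  Matrix.of fun j i =>
    (mfderiv 𝓘(ℝ, E) 𝓘(ℝ, Fin n → ℝ) ψ (ψ.symm x) (leftField e i (ψ.symm x)) : Fin n → ℝ) j

/-- The matrix `‖η(x)‖` of the components in `ψ_* η_i = η^j_i(x) ∂_{x^j}` (row `j`, column `i`). -/
def eta (ψ : OpenPartialHomeomorph G (Fin n → ℝ)) (x : Fin n → ℝ) :
    Matrix (Fin n) (Fin n) ℝ :=
  Matrix.of fun j i =>
    (mfderiv 𝓘(ℝ, E) 𝓘(ℝ, Fin n → ℝ) ψ (ψ.symm x) (rightField e i (ψ.symm x)) : Fin n → ℝ) j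

/-! ### Second canonical coordinates -/

/-- The group element `exp(x^n e_n) ⋯ exp(x^1 e_1)`. -/
def expProd (x : Fin n → ℝ) : G :=
  (List.ofFn fun i : Fin n => lieExp (x i • e i)).reverse.prod

/-- `ψ`, a diffeomorphism from an open neighbourhood of the identity of `G` onto an open
neighbourhood of `0` in `ℝⁿ`, is a system of second canonical coordinates relative to the basis
`e`: the element with coordinates `x` is `g_x = exp(x^n e_n) ⋯ exp(x^1 e_1)`. -/
structure IsSecondCanonical (ψ : OpenPartialHomeomorph G (Fin n → ℝ)) : Prop where
  contMDiffOn : ContMDiffOn 𝓘(ℝ, E) 𝓘(ℝ, Fin n → ℝ) ∞ ψ ψ.source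
  contMDiffOn_symm : ContMDiffOn 𝓘(ℝ, Fin n → ℝ) 𝓘(ℝ, E) ∞ ψ.symm ψ.target
  zero_mem_target : (0 : Fin n → ℝ) ∈ ψ.target
  symm_apply : ∀ x ∈ ψ.target, ψ.symm x = expProd e x

end Basics

end LieGroupCoords

end

/-!
The coordinate formulas follow from two facts.

The first is `Ad (exp (t e_j)) = exp (t ad e_j)` (`AdMatrix_lieExp_smul`). Uniqueness of integral
curves makes `t ↦ exp (tX)` a one-parameter subgroup (`lieExp_add_smul`) and `Ad` is multiplicative,
so `t ↦ ‖Ad (exp (t e_j))‖` is a one-parameter group of matrices and equals the exponential of its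
derivative at `0` (`eq_exp_smul_of_add_eq_mul`). This derivative is computed in the chart at the
identity. If `m` is the group law there and `o` the image of the identity, the left-invariant field
generated by `B` is `x ↦ ∂₂m(x, o) B`, so that `[A, B]` is the antisymmetrization of the mixed
second derivative of `m` at `(o, o)` (`chartDeriv_lie`). Differentiating the relation
`(R_g)_* Ad_g B = (L_g)_* B`, that is `∂₁m(o, g) Ad_g B = ∂₂m(g, o) B`, along `g = exp (sA)` gives
the same expression (`hasDerivAt_chartDeriv_Ad`).

The second is an identity in the group: with `p = exp (x^{k-1} e_{k-1}) ⋯ exp (x^1 e_1)`, moving the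
`k`-th coordinate of `g_x` by `t` multiplies `g_x` on the right by `p⁻¹ exp (t e_k) p`
(`inv_expProd_mul_expProd`). Hence `(L_{g_x⁻¹})_* ∂_{x^k} g_x = Ad_{p⁻¹} e_k`, whose components are
the `k`-th column of `‖ω(x)‖` (`IsSecondCanonical.omega_apply`).

The remaining statements are linear algebra: `Ad_g` carries left trivializations to right ones, and
contracting dual frames in coordinates gives `‖ω‖‖ξ‖ = 1` and `‖σ‖‖η‖ = 1`.
-/

noncomputable section

namespace LieGroupCoords

section

variable {E : Type*} [NormedAddCommGroup E] [NormedSpace ℝ E]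
  {G : Type*} [TopologicalSpace G] [ChartedSpace E G] [Group G] [LieGroup 𝓘(ℝ, E) ∞ G]

/-! ### Differentials of translations -/

lemma mdifferentiableAt_mul_left (g h : G) :
    MDifferentiableAt 𝓘(ℝ, E) 𝓘(ℝ, E) (fun b : G => g * b) h :=
  (contMDiff_mul_left (I := 𝓘(ℝ, E)) (n := ∞) (a := g)).mdifferentiable (by simp) h

lemma mdifferentiableAt_mul_right (g h : G) :
    MDifferentiableAt 𝓘(ℝ, E) 𝓘(ℝ, E) (fun b : G => b * g) h :=
  (contMDiff_mul_right (I := 𝓘(ℝ, E)) (n := ∞) (a := g)).mdifferentiable (by simp) h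

lemma mdifferentiableAt_conj (g h : G) :
    MDifferentiableAt 𝓘(ℝ, E) 𝓘(ℝ, E) (fun b : G => g * b * g⁻¹) h :=
  (mdifferentiableAt_mul_right g⁻¹ (g * h)).comp (I' := 𝓘(ℝ, E)) h
    (mdifferentiableAt_mul_left g h)

lemma mfderiv_mul_left_comp (a g h : G) (v : TangentSpace 𝓘(ℝ, E) h) :
    mfderiv 𝓘(ℝ, E) 𝓘(ℝ, E) (fun b : G => a * b) (g * h)
      (mfderiv 𝓘(ℝ, E) 𝓘(ℝ, E) (fun b : G => g * b) h v) =
    mfderiv 𝓘(ℝ, E) 𝓘(ℝ, E) (fun b : G => a * g * b) h v := by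
  have key := mfderiv_comp_apply (I' := 𝓘(ℝ, E)) h (mdifferentiableAt_mul_left (E := E) a (g * h))
    (mdifferentiableAt_mul_left (E := E) g h) v
  rw [← key]
  have : (fun b : G => a * b) ∘ (fun b => g * b) = fun b => a * g * b := by
    ext b; simp [mul_assoc]
  rw [this]

lemma mfderiv_mul_right_comp (a g h : G) (v : TangentSpace 𝓘(ℝ, E) h) :
    mfderiv 𝓘(ℝ, E) 𝓘(ℝ, E) (fun b : G => b * a) (h * g)
      (mfderiv 𝓘(ℝ, E) 𝓘(ℝ, E) (fun b : G => b * g) h v) =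
    mfderiv 𝓘(ℝ, E) 𝓘(ℝ, E) (fun b : G => b * (g * a)) h v := by
  have key := mfderiv_comp_apply (I' := 𝓘(ℝ, E)) h (mdifferentiableAt_mul_right (E := E) a (h * g))
    (mdifferentiableAt_mul_right (E := E) g h) v
  rw [← key]
  have : (fun b : G => b * a) ∘ (fun b => b * g) = fun b => b * (g * a) := by
    ext b; simp [mul_assoc]
  rw [this]

/-- The differentials of `L_{g⁻¹}` at `g` and of `L_g` at `1` are inverse to each other. As elsewhere
below, the equation is ascribed to the model space `E`, of which every tangent space is a copy,
because `g⁻¹ * g` and `g * 1` are only propositionally equal to `1` and `g`. -/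
lemma mfderiv_inv_mul_left_mul_left (g : G) (v : GroupLieAlgebra 𝓘(ℝ, E) G) :
    (mfderiv 𝓘(ℝ, E) 𝓘(ℝ, E) (fun b : G => g⁻¹ * b) g
      (mfderiv 𝓘(ℝ, E) 𝓘(ℝ, E) (fun b : G => g * b) 1 v) : E) = v := by
  have h := mfderiv_mul_left_comp g⁻¹ g 1 v
  have h2 : (fun b : G => g⁻¹ * g * b) = id := by ext; simp
  rw [h2, mfderiv_id, mul_one] at h
  exact h

lemma mfderiv_mul_left_inv_mul_left (g : G) (v : TangentSpace 𝓘(ℝ, E) g) :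
    (mfderiv 𝓘(ℝ, E) 𝓘(ℝ, E) (fun b : G => g * b) 1
      (mfderiv 𝓘(ℝ, E) 𝓘(ℝ, E) (fun b : G => g⁻¹ * b) g v) : E) = v := by
  have h := mfderiv_mul_left_comp g g⁻¹ g v
  have h2 : (fun b : G => g * g⁻¹ * b) = id := by ext; simp
  rw [h2, mfderiv_id, inv_mul_cancel] at h
  exact h

lemma mfderiv_inv_mul_right_mul_right (g : G) (v : GroupLieAlgebra 𝓘(ℝ, E) G) :
    (mfderiv 𝓘(ℝ, E) 𝓘(ℝ, E) (fun b : G => b * g⁻¹) g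
      (mfderiv 𝓘(ℝ, E) 𝓘(ℝ, E) (fun b : G => b * g) 1 v) : E) = v := by
  have h := mfderiv_mul_right_comp g⁻¹ g 1 v
  have h2 : (fun b : G => b * (g * g⁻¹)) = id := by ext; simp
  rw [h2, mfderiv_id, one_mul] at h
  exact h

/-! ### The adjoint representation of the group -/

/-- The defining relation `(R_g)_* Ad_g = (L_g)_*`. -/
lemma mfderiv_mul_right_Ad (g : G) (v : GroupLieAlgebra 𝓘(ℝ, E) G) :
    (mfderiv 𝓘(ℝ, E) 𝓘(ℝ, E) (fun b : G => b * g) 1 (Ad g v) : E) =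
      mfderiv 𝓘(ℝ, E) 𝓘(ℝ, E) (fun b : G => g * b) 1 v := by
  have key := mfderiv_comp_apply (I' := 𝓘(ℝ, E)) (1 : G)
    (mdifferentiableAt_mul_right (E := E) g (g * 1 * g⁻¹)) (mdifferentiableAt_conj (E := E) g 1) v
  have h2 : (fun b : G => b * g) ∘ (fun b => g * b * g⁻¹) = fun b => g * b := by
    ext b; simp
  rw [h2] at key
  have h3 : g * 1 * g⁻¹ = 1 := by simp
  rw [h3] at key
  exact key.symm

/-- `Ad_g` carries the left trivialization of a tangent vector to its right trivialization. -/
lemma mfderiv_mul_right_inv_eq_Ad (g : G) (v : TangentSpace 𝓘(ℝ, E) g) :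
    (mfderiv 𝓘(ℝ, E) 𝓘(ℝ, E) (fun b : G => b * g⁻¹) g v : E) =
      Ad g (mfderiv 𝓘(ℝ, E) 𝓘(ℝ, E) (fun b : G => g⁻¹ * b) g v : E) := by
  have h1 := mfderiv_mul_right_Ad g
    (mfderiv 𝓘(ℝ, E) 𝓘(ℝ, E) (fun b : G => g⁻¹ * b) g v : E)
  rw [mfderiv_mul_left_inv_mul_left] at h1
  have h2 := mfderiv_inv_mul_right_mul_right g
    (Ad g (mfderiv 𝓘(ℝ, E) 𝓘(ℝ, E) (fun b : G => g⁻¹ * b) g v : E))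
  rw [← h2]
  exact congrArg (mfderiv 𝓘(ℝ, E) 𝓘(ℝ, E) (fun b : G => b * g⁻¹) g : E →L[ℝ] E) h1.symm

lemma Ad_mul (g h : G) : Ad (E := E) (g * h) = Ad g * Ad h := by
  ext v
  have key := mfderiv_comp_apply (I' := 𝓘(ℝ, E)) (1 : G)
    (mdifferentiableAt_conj (E := E) g (h * 1 * h⁻¹)) (mdifferentiableAt_conj (E := E) h 1) v
  have h2 : (fun b : G => g * b * g⁻¹) ∘ (fun b => h * b * h⁻¹) =
      fun b => g * h * b * (g * h)⁻¹ := by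
    ext b; simp [mul_assoc]
  rw [h2] at key
  have h3 : h * 1 * h⁻¹ = 1 := by simp
  rw [h3] at key
  exact key

omit [LieGroup 𝓘(ℝ, E) ∞ G] in
lemma Ad_one : Ad (E := E) (1 : G) = 1 := by
  ext v
  have h2 : (fun b : G => 1 * b * 1⁻¹) = id := by ext b; simp
  have : mfderiv 𝓘(ℝ, E) 𝓘(ℝ, E) (fun b : G => 1 * b * 1⁻¹) 1 v = v := by
    rw [h2, mfderiv_id]; rfl
  exact this

variable [FiniteDimensional ℝ E]

/-! ### One-parameter subgroups -/

omit [FiniteDimensional ℝ E] in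
/-- A left-invariant vector field has only one integral curve with a given initial value. -/
lemma eq_of_isMIntegralCurve_mulInvariantVectorField {X : GroupLieAlgebra 𝓘(ℝ, E) G}
    {γ γ' : ℝ → G} (hγ : IsMIntegralCurve (I := 𝓘(ℝ, E)) γ (mulInvariantVectorField X))
    (hγ' : IsMIntegralCurve (I := 𝓘(ℝ, E)) γ' (mulInvariantVectorField X)) (h : γ 0 = γ' 0) :
    γ = γ' := by
  have : IsTopologicalGroup G := topologicalGroup_of_lieGroup 𝓘(ℝ, E) ∞
  have : T1Space G := 𝓘(ℝ, E).t1Space G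
  have : IsManifold 𝓘(ℝ, E) 1 G := IsManifold.of_le (n := ∞) (by simp)
  have hv := (contMDiff_mulInvariantVectorField (I := 𝓘(ℝ, E)) X).of_le
    (show (1 : ℕ∞ω) ≤ minSmoothness ℝ 2 by
      rw [minSmoothness_of_isRCLikeNormedField]; exact one_le_two)
  exact isMIntegralCurve_Ioo_eq_of_contMDiff_boundaryless (t₀ := 0) hv hγ hγ' h

/-- The curve `t ↦ exp (t X)` is the integral curve through the identity of the left-invariant
vector field generated by `X`. -/
lemma isMIntegralCurve_lieExp (X : GroupLieAlgebra 𝓘(ℝ, E) G) :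
    IsMIntegralCurve (I := 𝓘(ℝ, E)) (fun t : ℝ => lieExp (t • X)) (mulInvariantVectorField X) := by
  obtain ⟨γ, h0, hγ⟩ := exists_integralCurve X
  have key : (fun t : ℝ => lieExp (t • X)) = γ := by
    ext t
    obtain ⟨h0', hγ'⟩ := (exists_integralCurve (t • X)).choose_spec
    have h1 := hγ.comp_mul t
    rw [← mulInvariantVectorField_smul] at h1
    have h2 := eq_of_isMIntegralCurve_mulInvariantVectorField hγ' h1 (by simp [h0', h0])
    have := congrFun h2 1
    simpa [lieExp] using this
  rw [key]; exact hγ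

lemma lieExp_zero : lieExp (0 : GroupLieAlgebra 𝓘(ℝ, E) G) = 1 := by
  obtain ⟨h0, hγ⟩ := (exists_integralCurve (0 : GroupLieAlgebra 𝓘(ℝ, E) G)).choose_spec
  have h1 := eq_of_isMIntegralCurve_mulInvariantVectorField hγ
    (γ' := fun _ => 1)
    (isMIntegralCurve_const (by simp only [mulInvariantVectorField, map_zero]; rfl)) h0
  exact congrFun h1 1

omit [FiniteDimensional ℝ E] in
lemma isMIntegralCurve_mul_left {X : GroupLieAlgebra 𝓘(ℝ, E) G} {γ : ℝ → G}
    (hγ : IsMIntegralCurve (I := 𝓘(ℝ, E)) γ (mulInvariantVectorField X)) (g : G) :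
    IsMIntegralCurve (I := 𝓘(ℝ, E)) (fun t => g * γ t) (mulInvariantVectorField X) := by
  intro t
  have h2 := (mdifferentiableAt_mul_left (E := E) g (γ t)).hasMFDerivAt.comp t (hγ t)
  have heq : (mfderiv 𝓘(ℝ, E) 𝓘(ℝ, E) (fun b : G => g * b) (γ t)).comp
      ((1 : ℝ →L[ℝ] ℝ).smulRight (mulInvariantVectorField X (γ t)))
      = (1 : ℝ →L[ℝ] ℝ).smulRight (mulInvariantVectorField X (g * γ t)) := by
    rw [← mfderiv_mulInvariantVectorField]
    apply ContinuousLinearMap.ext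
    intro c
    exact map_smul (mfderiv 𝓘(ℝ, E) 𝓘(ℝ, E) (fun b : G => g * b) (γ t)) _ _
  rw [← heq]
  exact h2

lemma lieExp_add_smul (s t : ℝ) (X : GroupLieAlgebra 𝓘(ℝ, E) G) :
    lieExp ((s + t) • X) = lieExp (s • X) * lieExp (t • X) := by
  have h := isMIntegralCurve_lieExp X
  have h1 := eq_of_isMIntegralCurve_mulInvariantVectorField (h.comp_add s)
    (isMIntegralCurve_mul_left h (lieExp (s • X))) (by simp [lieExp_zero])
  simpa [add_comm] using congrFun h1 t

lemma lieExp_neg_smul (t : ℝ) (X : GroupLieAlgebra 𝓘(ℝ, E) G) :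
    lieExp (-(t • X)) = (lieExp (t • X))⁻¹ := by
  rw [eq_inv_iff_mul_eq_one, ← neg_smul, ← lieExp_add_smul, neg_add_cancel, zero_smul, lieExp_zero]

/-- The velocity of `t ↦ exp (t X)` at `0` is `X`. -/
lemma hasMFDerivAt_lieExp_zero (X : GroupLieAlgebra 𝓘(ℝ, E) G) :
    HasMFDerivAt 𝓘(ℝ, ℝ) 𝓘(ℝ, E) (fun t : ℝ => lieExp (t • X)) 0
      ((1 : ℝ →L[ℝ] ℝ).smulRight (X : E) : ℝ →L[ℝ] E) := by
  have h := isMIntegralCurve_lieExp X 0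
  have h1 : (mulInvariantVectorField X (lieExp ((0 : ℝ) • X)) : E) = X := by
    rw [zero_smul, lieExp_zero]
    have h2 : (fun b : G => 1 * b) = id := by ext; simp
    simp only [mulInvariantVectorField]
    rw [h2, mfderiv_id]; rfl
  have h3 : ((1 : ℝ →L[ℝ] ℝ).smulRight (mulInvariantVectorField X (lieExp ((0 : ℝ) • X)) : E) :
      ℝ →L[ℝ] E) = (1 : ℝ →L[ℝ] ℝ).smulRight (X : E) := congrArg _ h1
  exact h3 ▸ h

end

section

/-! ### The differential of the adjoint representation -/

open Filter Topology VectorField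

lemma two_le_infty : (2 : ℕ∞ω) ≤ ∞ :=
  WithTop.coe_le_coe.2 le_top

/-- If `R s (a s) = b s` with `R` and `b` differentiable and `R t = 1`, then `a` is differentiable
at `t`, because `R s` is invertible for `s` near `t`; its derivative is given by the product rule. -/
lemma hasDerivAt_of_clm_apply_eventuallyEq {F : Type*} [NormedAddCommGroup F] [NormedSpace ℝ F]
    [CompleteSpace F] {R : ℝ → F →L[ℝ] F} {R' : F →L[ℝ] F} {a b : ℝ → F} {a₀ b' : F} {t : ℝ}
    (hR : HasDerivAt R R' t) (h1 : R t = 1) (hb : HasDerivAt b b' t) (ha : a t = a₀)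
    (h : ∀ᶠ s in 𝓝 t, R s (a s) = b s) : HasDerivAt a (b' - R' a₀) t := by
  subst ha
  have hinv : HasDerivAt (fun s => Ring.inverse (R s)) (-R') t := by
    have h2 := hasFDerivAt_ringInverse (𝕜 := ℝ) (1 : (F →L[ℝ] F)ˣ)
    rw [Units.val_one, ← h1] at h2
    have h3 := h2.comp_hasDerivAt t hR
    simpa using! h3
  have hat : a t = b t := by have := h.self_of_nhds; rwa [h1] at this
  have h4 := hinv.clm_apply hb
  have h5 : b' - R' (a t) = (-R') (b t) + Ring.inverse (R t) b' := by
    rw [h1, hat, Ring.inverse_one]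
    simp [sub_eq_add_neg, add_comm]
  rw [h5]
  refine h4.congr_of_eventuallyEq ?_
  have hu : ∀ᶠ s in 𝓝 t, IsUnit (R s) := by
    refine hR.continuousAt.eventually (p := IsUnit) ?_
    rw [h1]
    exact Units.isOpen.mem_nhds isUnit_one
  filter_upwards [h, hu] with s hs hus
  rw [← hs, ← mul_apply_eq_comp, Ring.inverse_mul_cancel _ hus]
  rfl

variable {E : Type*} [NormedAddCommGroup E] [NormedSpace ℝ E]
  {G : Type*} [TopologicalSpace G] [ChartedSpace E G] [Group G]

variable (E G) in
/-- The group law read in the preferred chart at the identity. It is only meaningful near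
`(φ 1, φ 1)`, where `φ` is this chart. -/
def chartMul (p : E × E) : E :=
  extChartAt 𝓘(ℝ, E) (1 : G)
    ((extChartAt 𝓘(ℝ, E) (1 : G)).symm p.1 * (extChartAt 𝓘(ℝ, E) (1 : G)).symm p.2)

variable (E G) in
/-- The coordinates of the identity in the preferred chart there. -/
def chartOne : E := extChartAt 𝓘(ℝ, E) (1 : G) 1

variable (E G) in
/-- The differential at the identity of the preferred chart there. -/
def chartDeriv : GroupLieAlgebra 𝓘(ℝ, E) G →L[ℝ] E :=
  mfderiv 𝓘(ℝ, E) 𝓘(ℝ, E) (extChartAt 𝓘(ℝ, E) (1 : G)) 1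

variable [LieGroup 𝓘(ℝ, E) ∞ G]

lemma isManifold_one_of_lieGroup (E G : Type*) [NormedAddCommGroup E] [NormedSpace ℝ E]
    [TopologicalSpace G] [ChartedSpace E G] [Group G] [LieGroup 𝓘(ℝ, E) ∞ G] :
    IsManifold 𝓘(ℝ, E) 1 G := IsManifold.of_le (n := ∞) (by simp)

lemma isInvertible_chartDeriv : (chartDeriv E G).IsInvertible := by
  have := isManifold_one_of_lieGroup E G
  exact isInvertible_mfderiv_extChartAt (mem_extChartAt_source (I := 𝓘(ℝ, E)) (1 : G))

lemma contDiffAt_chartMul :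
    ContDiffAt ℝ 2 (chartMul E G) (chartOne E G, chartOne E G) := by
  have : IsManifold 𝓘(ℝ, E) 2 G := IsManifold.of_le (n := ∞) two_le_infty
  have : LieGroup 𝓘(ℝ, E) 2 G := LieGroup.of_le (n := ∞) two_le_infty
  rw [← contMDiffAt_iff_contDiffAt]
  have hs : ContMDiffAt 𝓘(ℝ, E) 𝓘(ℝ, E) 2 (extChartAt 𝓘(ℝ, E) (1 : G)).symm (chartOne E G) :=
    (contMDiffOn_extChartAt_symm (1 : G)).contMDiffAt (extChartAt_target_mem_nhds (1 : G))
  have h1 : ContMDiffAt 𝓘(ℝ, E × E) 𝓘(ℝ, E) 2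
      (fun p : E × E => (extChartAt 𝓘(ℝ, E) (1 : G)).symm p.1) (chartOne E G, chartOne E G) :=
    ContMDiffAt.comp (I' := 𝓘(ℝ, E)) (chartOne E G, chartOne E G)
      (f := fun p : E × E => p.1) hs contDiff_fst.contMDiff.contMDiffAt
  have h2 : ContMDiffAt 𝓘(ℝ, E × E) 𝓘(ℝ, E) 2
      (fun p : E × E => (extChartAt 𝓘(ℝ, E) (1 : G)).symm p.2) (chartOne E G, chartOne E G) :=
    ContMDiffAt.comp (I' := 𝓘(ℝ, E)) (chartOne E G, chartOne E G)
      (f := fun p : E × E => p.2) hs contDiff_snd.contMDiff.contMDiffAt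
  refine ContMDiffAt.comp (I' := 𝓘(ℝ, E)) (chartOne E G, chartOne E G)
    (f := fun p : E × E => (extChartAt 𝓘(ℝ, E) (1 : G)).symm p.1 *
      (extChartAt 𝓘(ℝ, E) (1 : G)).symm p.2) ?_ (h1.mul h2)
  have h3 : (extChartAt 𝓘(ℝ, E) (1 : G)).symm (chartOne E G) = 1 :=
    extChartAt_to_inv (I := 𝓘(ℝ, E)) (1 : G)
  rw [h3, mul_one]
  exact contMDiffAt_extChartAt

omit [LieGroup 𝓘(ℝ, E) ∞ G] in
lemma tendsto_extChartAt_one :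
    Tendsto (extChartAt 𝓘(ℝ, E) (1 : G)) (𝓝 1) (𝓝 (chartOne E G)) :=
  continuousAt_extChartAt (1 : G)

lemma eventually_differentiableAt_chartMul :
    ∀ᶠ p in 𝓝 (chartOne E G, chartOne E G), DifferentiableAt ℝ (chartMul E G) p :=
  ((contDiffAt_chartMul (E := E) (G := G)).eventually (by simp)).mono fun _ hp =>
    hp.differentiableAt (by simp)

lemma mdifferentiableAt_extChartAt_one {g : G} (hg : g ∈ (extChartAt 𝓘(ℝ, E) (1 : G)).source) :
    MDifferentiableAt 𝓘(ℝ, E) 𝓘(ℝ, E) (extChartAt 𝓘(ℝ, E) (1 : G)) g := by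
  have := isManifold_one_of_lieGroup E G
  exact mdifferentiableAt_extChartAt (by simpa using hg)

/-- The left-invariant vector field generated by `B`, in the chart at the identity. -/
lemma eventually_mfderiv_extChartAt_mul_left :
    ∀ᶠ g in 𝓝 (1 : G), ∀ B : GroupLieAlgebra 𝓘(ℝ, E) G,
      (mfderiv 𝓘(ℝ, E) 𝓘(ℝ, E) (extChartAt 𝓘(ℝ, E) (1 : G)) g
        (mfderiv 𝓘(ℝ, E) 𝓘(ℝ, E) (fun b : G => g * b) 1 B) : E) =
      fderiv ℝ (chartMul E G) (extChartAt 𝓘(ℝ, E) (1 : G) g, chartOne E G)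
        (0, chartDeriv E G B) := by
  have hc : Tendsto (fun g : G => (extChartAt 𝓘(ℝ, E) (1 : G) g, chartOne E G)) (𝓝 1)
      (𝓝 (chartOne E G, chartOne E G)) :=
    tendsto_extChartAt_one.prodMk_nhds tendsto_const_nhds
  filter_upwards [hc.eventually eventually_differentiableAt_chartMul,
    extChartAt_source_mem_nhds (I := 𝓘(ℝ, E)) (1 : G)] with g hg hgs B
  have hg1 : g * 1 ∈ (extChartAt 𝓘(ℝ, E) (1 : G)).source := by simpa using hgs
  have e1 := mfderiv_comp_apply (I' := 𝓘(ℝ, E)) (1 : G)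
    (mdifferentiableAt_extChartAt_one (E := E) hg1) (mdifferentiableAt_mul_left (E := E) g 1) B
  have h1 : HasFDerivAt (fun y : E => chartMul E G (extChartAt 𝓘(ℝ, E) (1 : G) g, y))
      ((fderiv ℝ (chartMul E G) (extChartAt 𝓘(ℝ, E) (1 : G) g, chartOne E G)).comp
        (ContinuousLinearMap.inr ℝ E E)) (chartOne E G) :=
    hg.hasFDerivAt.comp _ (hasFDerivAt_prodMk_right _ _)
  have h2 := h1.hasMFDerivAt.comp (1 : G) (mdifferentiableAt_extChartAt_one (E := E)
    (mem_extChartAt_source (I := 𝓘(ℝ, E)) (1 : G))).hasMFDerivAt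
  have h3 : (extChartAt 𝓘(ℝ, E) (1 : G)) ∘ (fun b : G => g * b) =ᶠ[𝓝 1]
      (fun y : E => chartMul E G (extChartAt 𝓘(ℝ, E) (1 : G) g, y)) ∘
        (extChartAt 𝓘(ℝ, E) (1 : G)) := by
    filter_upwards [extChartAt_source_mem_nhds (I := 𝓘(ℝ, E)) (1 : G)] with b hb
    simp only [Function.comp, chartMul]
    rw [(extChartAt 𝓘(ℝ, E) (1 : G)).left_inv hgs, (extChartAt 𝓘(ℝ, E) (1 : G)).left_inv hb]
  rw [h3.mfderiv_eq] at e1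
  erw [h2.mfderiv] at e1
  rw [mul_one] at e1
  exact e1.symm

/-- The right-invariant vector field generated by `B`, in the chart at the identity. -/
lemma eventually_mfderiv_extChartAt_mul_right :
    ∀ᶠ g in 𝓝 (1 : G), ∀ B : GroupLieAlgebra 𝓘(ℝ, E) G,
      (mfderiv 𝓘(ℝ, E) 𝓘(ℝ, E) (extChartAt 𝓘(ℝ, E) (1 : G)) g
        (mfderiv 𝓘(ℝ, E) 𝓘(ℝ, E) (fun b : G => b * g) 1 B) : E) =
      fderiv ℝ (chartMul E G) (chartOne E G, extChartAt 𝓘(ℝ, E) (1 : G) g)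
        (chartDeriv E G B, 0) := by
  have hc : Tendsto (fun g : G => (chartOne E G, extChartAt 𝓘(ℝ, E) (1 : G) g)) (𝓝 1)
      (𝓝 (chartOne E G, chartOne E G)) :=
    tendsto_const_nhds.prodMk_nhds tendsto_extChartAt_one
  filter_upwards [hc.eventually eventually_differentiableAt_chartMul,
    extChartAt_source_mem_nhds (I := 𝓘(ℝ, E)) (1 : G)] with g hg hgs B
  have hg1 : 1 * g ∈ (extChartAt 𝓘(ℝ, E) (1 : G)).source := by simpa using hgs
  have e1 := mfderiv_comp_apply (I' := 𝓘(ℝ, E)) (1 : G)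
    (mdifferentiableAt_extChartAt_one (E := E) hg1) (mdifferentiableAt_mul_right (E := E) g 1) B
  have h1 : HasFDerivAt (fun y : E => chartMul E G (y, extChartAt 𝓘(ℝ, E) (1 : G) g))
      ((fderiv ℝ (chartMul E G) (chartOne E G, extChartAt 𝓘(ℝ, E) (1 : G) g)).comp
        (ContinuousLinearMap.inl ℝ E E)) (chartOne E G) :=
    HasFDerivAt.comp (f := fun y : E => (y, extChartAt 𝓘(ℝ, E) (1 : G) g)) _ hg.hasFDerivAt
      (hasFDerivAt_prodMk_left _ _)
  have h2 := h1.hasMFDerivAt.comp (1 : G) (mdifferentiableAt_extChartAt_one (E := E)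
    (mem_extChartAt_source (I := 𝓘(ℝ, E)) (1 : G))).hasMFDerivAt
  have h3 : (extChartAt 𝓘(ℝ, E) (1 : G)) ∘ (fun b : G => b * g) =ᶠ[𝓝 1]
      (fun y : E => chartMul E G (y, extChartAt 𝓘(ℝ, E) (1 : G) g)) ∘
        (extChartAt 𝓘(ℝ, E) (1 : G)) := by
    filter_upwards [extChartAt_source_mem_nhds (I := 𝓘(ℝ, E)) (1 : G)] with b hb
    simp only [Function.comp, chartMul]
    rw [(extChartAt 𝓘(ℝ, E) (1 : G)).left_inv hgs, (extChartAt 𝓘(ℝ, E) (1 : G)).left_inv hb]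
  rw [h3.mfderiv_eq] at e1
  erw [h2.mfderiv] at e1
  rw [one_mul] at e1
  exact e1.symm

lemma fderiv_chartMul_zero_right (v : E) :
    fderiv ℝ (chartMul E G) (chartOne E G, chartOne E G) (0, v) = v := by
  obtain ⟨B, rfl⟩ := (isInvertible_chartDeriv (E := E) (G := G)).bijective.surjective v
  have h := (eventually_mfderiv_extChartAt_mul_left (E := E) (G := G)).self_of_nhds B
  have h2 : (fun b : G => 1 * b) = id := by ext; simp
  rw [h2, mfderiv_id] at h
  exact h.symm

lemma fderiv_chartMul_zero_left (v : E) :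
    fderiv ℝ (chartMul E G) (chartOne E G, chartOne E G) (v, 0) = v := by
  obtain ⟨B, rfl⟩ := (isInvertible_chartDeriv (E := E) (G := G)).bijective.surjective v
  have h := (eventually_mfderiv_extChartAt_mul_right (E := E) (G := G)).self_of_nhds B
  have h2 : (fun b : G => b * 1) = id := by ext; simp
  rw [h2, mfderiv_id] at h
  exact h.symm

/-- The second differential of the group law at the identity determines the Lie bracket: it is the
antisymmetrization of the mixed second derivative. -/
lemma chartDeriv_lie (A B : GroupLieAlgebra 𝓘(ℝ, E) G) :
    chartDeriv E G ⁅A, B⁆ =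
      fderiv ℝ (fderiv ℝ (chartMul E G)) (chartOne E G, chartOne E G)
        (chartDeriv E G A, 0) (0, chartDeriv E G B) -
      fderiv ℝ (fderiv ℝ (chartMul E G)) (chartOne E G, chartOne E G)
        (chartDeriv E G B, 0) (0, chartDeriv E G A) := by
  have := isManifold_one_of_lieGroup E G
  -- The pullbacks through the chart appearing in the definition of the bracket.
  have hpull : ∀ C : GroupLieAlgebra 𝓘(ℝ, E) G,
      mpullbackWithin 𝓘(ℝ, E) 𝓘(ℝ, E) (extChartAt 𝓘(ℝ, E) (1 : G)).symm
        (mulInvariantVectorField C) (Set.range 𝓘(ℝ, E)) =ᶠ[𝓝 (chartOne E G)]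
      fun x => fderiv ℝ (chartMul E G) (x, chartOne E G) (0, chartDeriv E G C) := by
    intro C
    have hs : Tendsto (extChartAt 𝓘(ℝ, E) (1 : G)).symm (𝓝 (chartOne E G)) (𝓝 1) := by
      have := continuousAt_extChartAt_symm (I := 𝓘(ℝ, E)) (1 : G)
      rwa [ContinuousAt, extChartAt_to_inv] at this
    filter_upwards [hs.eventually (eventually_mfderiv_extChartAt_mul_left (E := E) (G := G)),
      extChartAt_target_mem_nhds (I := 𝓘(ℝ, E)) (1 : G)] with x hx hxt
    have h1 := hx C
    rw [(extChartAt 𝓘(ℝ, E) (1 : G)).right_inv hxt] at h1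
    -- The pullback uses the inverse of the differential of the inverse chart, which is the
    -- differential of the chart.
    rw [← h1, mpullbackWithin_apply, ContinuousLinearMap.inverse_eq
      (mfderivWithin_extChartAt_symm_comp_mfderiv_extChartAt hxt)
      (mfderiv_extChartAt_comp_mfderivWithin_extChartAt_symm hxt)]
    rfl
  have hW : ∀ C : GroupLieAlgebra 𝓘(ℝ, E) G,
      HasFDerivAt (fun x => fderiv ℝ (chartMul E G) (x, chartOne E G) (0, chartDeriv E G C))
        (((ContinuousLinearMap.apply ℝ E (0, chartDeriv E G C)).comp
          (fderiv ℝ (fderiv ℝ (chartMul E G)) (chartOne E G, chartOne E G))).comp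
            (ContinuousLinearMap.inl ℝ E E)) (chartOne E G) := by
    intro C
    have h1 : HasFDerivAt (fderiv ℝ (chartMul E G)) _ (chartOne E G, chartOne E G) :=
      ((contDiffAt_chartMul (E := E) (G := G)).fderiv_right (m := 1)
        (by norm_num)).differentiableAt (by simp) |>.hasFDerivAt
    exact HasFDerivAt.comp (f := fun x : E => (x, chartOne E G)) _
      ((ContinuousLinearMap.apply ℝ E ((0, chartDeriv E G C) : E × E)).hasFDerivAt.comp _ h1)
      (hasFDerivAt_prodMk_left _ _)
  have hinv : chartDeriv E G ⁅A, B⁆ = lieBracket ℝ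
      (fun x => fderiv ℝ (chartMul E G) (x, chartOne E G) (0, chartDeriv E G A))
      (fun x => fderiv ℝ (chartMul E G) (x, chartOne E G) (0, chartDeriv E G B))
      (chartOne E G) := by
    rw [← (hpull A).lieBracket_vectorField_eq (hpull B), GroupLieAlgebra.bracket_def, mlieBracket,
      mlieBracketWithin_apply]
    have hr : (extChartAt 𝓘(ℝ, E) (1 : G)).symm ⁻¹' Set.univ ∩ Set.range 𝓘(ℝ, E) = Set.univ := by
      simp
    rw [hr]
    erw [lieBracketWithin_univ]
    exact (isInvertible_chartDeriv (E := E) (G := G)).self_apply_inverse _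
  rw [hinv, lieBracket, (hW A).fderiv, (hW B).fderiv, fderiv_chartMul_zero_right,
    fderiv_chartMul_zero_right]
  rfl

variable [FiniteDimensional ℝ E]

/-- `d/ds Ad_{exp (sA)} B = [A, B]` at `s = 0`, read in the chart at the identity. The identity
`(R_g)_* Ad_g = (L_g)_*` expresses `Ad` through the differential of the group law, and
differentiating it along `g = exp (sA)` gives the antisymmetrized mixed second derivative. -/
lemma hasDerivAt_chartDeriv_Ad (A B : GroupLieAlgebra 𝓘(ℝ, E) G) :
    HasDerivAt (fun s : ℝ => chartDeriv E G (Ad (lieExp (s • A)) B))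
      (chartDeriv E G ⁅A, B⁆) 0 := by
  have := FiniteDimensional.complete ℝ E
  -- With `c s` the coordinates of `exp (sA)`, the relation reads `R s (a s) = L s`, where
  -- `a s = Ad_{exp (sA)} B`, `L s = ∂₂m(c s, o) B` and `R s = ∂₁m(o, c s)`.
  set c : ℝ → E := fun s => extChartAt 𝓘(ℝ, E) (1 : G) (lieExp (s • A)) with hc_def
  have hc0 : c 0 = chartOne E G := by simp [hc_def, lieExp_zero, chartOne]
  have hc : HasDerivAt c (chartDeriv E G A) 0 := by
    have hs : lieExp ((0 : ℝ) • A) ∈ (extChartAt 𝓘(ℝ, E) (1 : G)).source := by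
      rw [zero_smul, lieExp_zero]; exact mem_extChartAt_source _
    let a : E := A
    let K : E →L[ℝ] E :=
      mfderiv 𝓘(ℝ, E) 𝓘(ℝ, E) (extChartAt 𝓘(ℝ, E) (1 : G)) (lieExp ((0 : ℝ) • A))
    have h1 : HasFDerivAt c (K.comp ((1 : ℝ →L[ℝ] ℝ).smulRight a)) 0 :=
      ((mdifferentiableAt_extChartAt_one (E := E) hs).hasMFDerivAt.comp (0 : ℝ)
        (hasMFDerivAt_lieExp_zero A)).hasFDerivAt
    have h2 : HasDerivAt c (K ((1 : ℝ) • a)) 0 := h1.hasDerivAt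
    have h3 : K ((1 : ℝ) • a) = chartDeriv E G A := by
      simp only [K]
      rw [zero_smul, lieExp_zero, one_smul]; rfl
    rwa [h3] at h2
  have hD : HasFDerivAt (fderiv ℝ (chartMul E G))
      (fderiv ℝ (fderiv ℝ (chartMul E G)) (chartOne E G, chartOne E G))
      (chartOne E G, chartOne E G) :=
    ((contDiffAt_chartMul (E := E) (G := G)).fderiv_right (m := 1)
      (by norm_num)).differentiableAt (by simp) |>.hasFDerivAt
  have hL : HasDerivAt (fun s => fderiv ℝ (chartMul E G) (c s, chartOne E G)
      (0, chartDeriv E G B)) (fderiv ℝ (fderiv ℝ (chartMul E G)) (chartOne E G, chartOne E G)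
        (chartDeriv E G A, 0) (0, chartDeriv E G B)) 0 := by
    have h1 : HasDerivAt (fun s => (c s, chartOne E G)) (chartDeriv E G A, 0) 0 :=
      hc.prodMk (hasDerivAt_const _ _)
    have h2 := HasFDerivAt.comp_hasDerivAt (l := fderiv ℝ (chartMul E G)) 0
      (by rw [hc0]; exact hD) h1
    simpa using! h2.clm_apply (hasDerivAt_const 0 ((0, chartDeriv E G B) : E × E))
  have hR : HasDerivAt (fun s => (fderiv ℝ (chartMul E G) (chartOne E G, c s)).comp
      (ContinuousLinearMap.inl ℝ E E))
      ((fderiv ℝ (fderiv ℝ (chartMul E G)) (chartOne E G, chartOne E G)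
        (0, chartDeriv E G A)).comp (ContinuousLinearMap.inl ℝ E E)) 0 := by
    have h1 : HasDerivAt (fun s => (chartOne E G, c s)) (0, chartDeriv E G A) 0 :=
      (hasDerivAt_const _ _).prodMk hc
    have h2 := HasFDerivAt.comp_hasDerivAt (l := fderiv ℝ (chartMul E G)) 0
      (by rw [hc0]; exact hD) h1
    simpa using! h2.clm_comp (hasDerivAt_const 0 (ContinuousLinearMap.inl ℝ E E))
  have hR1 : (fderiv ℝ (chartMul E G) (chartOne E G, c 0)).comp
      (ContinuousLinearMap.inl ℝ E E) = 1 := by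
    ext v
    rw [hc0]
    exact fderiv_chartMul_zero_left v
  have hcurve : Tendsto (fun s : ℝ => lieExp (s • A)) (𝓝 0) (𝓝 (1 : G)) := by
    have := (hasMFDerivAt_lieExp_zero A).continuousAt
    rwa [ContinuousAt, zero_smul, lieExp_zero] at this
  have key := hasDerivAt_of_clm_apply_eventuallyEq hR hR1 hL
    (a := fun s : ℝ => chartDeriv E G (Ad (lieExp (s • A)) B)) (a₀ := chartDeriv E G B)
    (by rw [zero_smul, lieExp_zero, Ad_one]; rfl) (by
      filter_upwards [hcurve.eventually (eventually_mfderiv_extChartAt_mul_left (E := E) (G := G)),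
        hcurve.eventually (eventually_mfderiv_extChartAt_mul_right (E := E) (G := G))] with s h1 h2
      rw [← h1 B]
      refine (h2 _).symm.trans ?_
      exact congrArg (mfderiv 𝓘(ℝ, E) 𝓘(ℝ, E) (extChartAt 𝓘(ℝ, E) (1 : G)) (lieExp (s • A)) :
        E →L[ℝ] E) (mfderiv_mul_right_Ad (lieExp (s • A)) B))
  -- By the product rule the derivative involves `D²m (0, A) (B, 0)`, which symmetry of `D²m` turns
  -- into the second term of the bracket.
  have hsymm := (contDiffAt_chartMul (E := E) (G := G)).isSymmSndFDerivAt (by simp)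
    (chartDeriv E G B, 0) (0, chartDeriv E G A)
  rw [chartDeriv_lie, hsymm]
  exact key

/-- The chart-free form of `hasDerivAt_chartDeriv_Ad`, tested against linear forms because the Lie
algebra carries no norm of its own. -/
lemma hasDerivAt_apply_Ad (f : GroupLieAlgebra 𝓘(ℝ, E) G →ₗ[ℝ] ℝ)
    (A B : GroupLieAlgebra 𝓘(ℝ, E) G) :
    HasDerivAt (fun s : ℝ => f (Ad (lieExp (s • A)) B)) (f ⁅A, B⁆) 0 := by
  obtain ⟨J, hJ⟩ := isInvertible_chartDeriv (E := E) (G := G)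
  have h := (f ∘ₗ J.symm.toLinearMap : E →ₗ[ℝ] ℝ).toContinuousLinearMap.hasFDerivAt
    |>.comp_hasDerivAt 0 (hasDerivAt_chartDeriv_Ad A B)
  rw [← hJ] at h
  simpa [Function.comp_def] using! h

end

section

/-! ### One-parameter groups of matrices -/

/-- A one-parameter group in a Banach algebra is the exponential of its derivative at `0`. -/
lemma eq_exp_smul_of_add_eq_mul {𝔸 : Type*} [NormedRing 𝔸] [NormedAlgebra ℝ 𝔸] [CompleteSpace 𝔸]
    {M : ℝ → 𝔸} {A : 𝔸} (hadd : ∀ s t, M (s + t) = M s * M t) (h0 : M 0 = 1)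
    (hM : HasDerivAt M A 0) (t : ℝ) : M t = NormedSpace.exp (t • A) := by
  -- `NormedSpace.exp` uses the structure of a `ℚ`-algebra.
  let := NormedAlgebra.restrictScalars ℚ ℝ 𝔸
  have hM' : ∀ t, HasDerivAt M (M t * A) t := by
    intro t
    have h1 : HasDerivAt (fun s => M t * M (s - t)) (M t * A) t := by
      refine HasDerivAt.const_mul (M t) ?_
      have h2 : HasDerivAt M A (t - t) := by rwa [sub_self]
      simpa using h2.comp_sub_const t t
    have h3 : (fun s => M t * M (s - t)) = M := by
      ext s; rw [← hadd, add_sub_cancel]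
    rwa [h3] at h1
  -- `M s * exp (-s A)` is constant.
  have hN : ∀ t, HasDerivAt (fun s : ℝ => M s * NormedSpace.exp ((-s) • A)) 0 t := by
    intro t
    have h1 : HasDerivAt (fun s : ℝ => NormedSpace.exp ((-s) • A))
        (-(A * NormedSpace.exp ((-t) • A))) t := by
      have h2 := (hasDerivAt_exp_smul_const' (𝕂 := ℝ) A (-t)).scomp t (hasDerivAt_neg t)
      simpa [Function.comp_def] using! h2
    have h3 := (hM' t).mul h1
    convert! h3 using 1
    simp [mul_assoc]
  have hc :=
    is_const_of_deriv_eq_zero (fun s => (hN s).differentiableAt) (fun s => (hN s).deriv) t 0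
  have h4 : NormedSpace.exp ((-t) • A) * NormedSpace.exp (t • A) = 1 := by
    rw [← NormedSpace.exp_add_of_commute (((Commute.refl A).smul_left _).smul_right _)]
    simp
  calc M t = M t * (NormedSpace.exp ((-t) • A) * NormedSpace.exp (t • A)) := by rw [h4, mul_one]
    _ = NormedSpace.exp (t • A) := by
      rw [← mul_assoc]
      rw [hc]; simp [h0]

section

open scoped Matrix.Norms.Operator

/-- Differentiation of a matrix is entrywise, for the operator norm on matrices. -/
lemma hasDerivAt_matrix_of_apply {n : ℕ} {M : ℝ → Matrix (Fin n) (Fin n) ℝ}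
    {M' : Matrix (Fin n) (Fin n) ℝ} {t : ℝ} (h : ∀ i j, HasDerivAt (fun s => M s i j) (M' i j) t) :
    HasDerivAt M M' t := by
  have h1 : M = fun s => ∑ i, ∑ j, M s i j • Matrix.single i j (1 : ℝ) := by
    ext1 s
    conv_lhs => rw [Matrix.matrix_eq_sum_single (M s)]
    simp
  have h2 : M' = ∑ i, ∑ j, M' i j • Matrix.single i j (1 : ℝ) := by
    conv_lhs => rw [Matrix.matrix_eq_sum_single M']
    simp
  rw [h1, h2]
  refine HasDerivAt.fun_sum fun i _ => HasDerivAt.fun_sum fun j _ => ?_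
  exact (h i j).smul_const _

lemma eq_exp_smul_of_hasDerivAt_apply {n : ℕ} {M : ℝ → Matrix (Fin n) (Fin n) ℝ}
    {A : Matrix (Fin n) (Fin n) ℝ} (hadd : ∀ s t, M (s + t) = M s * M t) (h0 : M 0 = 1)
    (hM : ∀ i j, HasDerivAt (fun s => M s i j) (A i j) 0) (t : ℝ) :
    M t = NormedSpace.exp (t • A) :=
  eq_exp_smul_of_add_eq_mul hadd h0 (hasDerivAt_matrix_of_apply hM) t

end

variable {E : Type*} [NormedAddCommGroup E] [NormedSpace ℝ E]
  {G : Type*} [TopologicalSpace G] [ChartedSpace E G] [Group G] [LieGroup 𝓘(ℝ, E) ∞ G]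
  {n : ℕ} (e : Module.Basis (Fin n) ℝ (GroupLieAlgebra 𝓘(ℝ, E) G))

lemma AdMatrix_mul (g h : G) : AdMatrix e (g * h) = AdMatrix e g * AdMatrix e h := by
  rw [AdMatrix, Ad_mul, LinearMap.toMatrix_mul]; rfl

omit [LieGroup 𝓘(ℝ, E) ∞ G] in
lemma AdMatrix_one : AdMatrix e (1 : G) = 1 := by
  rw [AdMatrix, Ad_one, LinearMap.toMatrix_one]

lemma AdMatrix_list_prod (l : List G) : AdMatrix e l.prod = (l.map (AdMatrix e)).prod := by
  induction l with
  | nil => simp [AdMatrix_one]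
  | cons g l ih => simp [AdMatrix_mul, ih]

variable [FiniteDimensional ℝ E]

/-- `Ad ∘ exp = exp ∘ ad` on the basis vectors, in matrix form. -/
lemma AdMatrix_lieExp_smul (t : ℝ) (j : Fin n) :
    AdMatrix e (lieExp (t • e j)) = NormedSpace.exp (t • adMatrix e j) := by
  refine eq_exp_smul_of_hasDerivAt_apply (M := fun t => AdMatrix e (lieExp (t • e j)))
    (fun s t => by rw [lieExp_add_smul, AdMatrix_mul]) (by simp only [zero_smul, lieExp_zero,
      AdMatrix_one]) (fun i k => ?_) t
  have h := hasDerivAt_apply_Ad (e.coord i) (e j) (e k)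
  simpa [AdMatrix, adMatrix, LinearMap.toMatrix_apply] using! h

end

section

variable {E : Type*} [NormedAddCommGroup E] [NormedSpace ℝ E]
  {G : Type*} [TopologicalSpace G] [ChartedSpace E G] [Group G] [LieGroup 𝓘(ℝ, E) ∞ G]
  [FiniteDimensional ℝ E] {n : ℕ} (e : Module.Basis (Fin n) ℝ (GroupLieAlgebra 𝓘(ℝ, E) G))

/-! ### Duality of the invariant frames -/

omit [FiniteDimensional ℝ E] in
lemma leftForm_leftField (g : G) (i j : Fin n) :
    leftForm e i g (leftField e j g) = if i = j then 1 else 0 := by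
  have h : leftForm e i g (leftField e j g) = e.coord i (e j) :=
    congrArg (e.coord i) (mfderiv_inv_mul_left_mul_left g (e j))
  rw [h, Module.Basis.coord_apply, Module.Basis.repr_self, Finsupp.single_apply]
  simp [eq_comm]

omit [FiniteDimensional ℝ E] in
lemma rightForm_rightField (g : G) (i j : Fin n) :
    rightForm e i g (rightField e j g) = if i = j then 1 else 0 := by
  have h : rightForm e i g (rightField e j g) = e.coord i (e j) := by
    let θ : E →ₗ[ℝ] ℝ := e.coord i
    let K : E →L[ℝ] E := mfderiv 𝓘(ℝ, E) 𝓘(ℝ, E) (fun b : G => b * g⁻¹) g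
    let w : E := mfderiv 𝓘(ℝ, E) 𝓘(ℝ, E) (fun b : G => b * g) 1 (e j)
    have h1 : -θ (K (-w)) = θ (K w) := by rw [map_neg, map_neg, neg_neg]
    exact h1.trans (congrArg θ (mfderiv_inv_mul_right_mul_right g (e j)))
  rw [h, Module.Basis.coord_apply, Module.Basis.repr_self, Finsupp.single_apply]
  simp [eq_comm]

omit [FiniteDimensional ℝ E] in
/-- `σ^i = -‖Ad_g‖^i_j ω^j` at `g`. -/
lemma rightForm_eq_neg_sum (g : G) (i : Fin n) (v : TangentSpace 𝓘(ℝ, E) g) :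
    rightForm e i g v = -∑ j, AdMatrix e g i j * leftForm e j g v := by
  have h1 : rightForm e i g v =
      -e.coord i (mfderiv 𝓘(ℝ, E) 𝓘(ℝ, E) (fun b : G => b * g⁻¹) g v : E) := rfl
  have h2 := congrFun (LinearMap.toMatrix_mulVec_repr e e (Ad g)
    (mfderiv 𝓘(ℝ, E) 𝓘(ℝ, E) (fun b : G => g⁻¹ * b) g v : E)) i
  rw [h1, mfderiv_mul_right_inv_eq_Ad, Module.Basis.coord_apply, ← h2]
  rfl

/-! ### Products of exponentials -/

/-- The partial product `exp (x_{k-1} e_{k-1}) ⋯ exp (x_0 e_0)` of the first `k` exponentials. -/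
def expProdTake (x : Fin n → ℝ) (k : ℕ) : G :=
  ((List.ofFn fun i : Fin n => lieExp (x i • e i)).take k).reverse.prod

/-- Changing the `k`-th coordinate inserts `exp (t e_k)` to the left of the partial product
`expProdTake e x k`; the remaining factors do not change. -/
lemma expProd_add_smul_single (x : Fin n → ℝ) (k : Fin n) (t : ℝ) :
    expProd e (x + t • Pi.single k (1 : ℝ)) =
      ((List.ofFn fun i : Fin n => lieExp (x i • e i)).drop (k + 1)).reverse.prod *
        lieExp (x k • e k) * lieExp (t • e k) * expProdTake e x k := by
  have h1 : (List.ofFn fun i : Fin n =>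
      lieExp ((x + t • (Pi.single k (1 : ℝ) : Fin n → ℝ)) i • e i)) =
      (List.ofFn fun i : Fin n => lieExp (x i • e i)).set k (lieExp ((x k + t) • e k)) := by
    refine List.ext_getElem (by simp) fun i h1 h2 => ?_
    rw [List.getElem_set]
    simp only [List.getElem_ofFn, Pi.add_apply, Pi.smul_apply, Pi.single_apply, Fin.ext_iff]
    split_ifs with h3 h4 h4
    · subst h3; simp
    · exact absurd h3.symm h4
    · exact absurd h4.symm h3
    · simp
  rw [expProd, h1, List.set_eq_take_append_cons_drop, if_pos (by simp), expProdTake,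
    lieExp_add_smul]
  simp [mul_assoc]

/-- Left translation by `g_x⁻¹` makes the `k`-th coordinate curve through `g_x` a conjugate of the
one-parameter group of `e_k`. The right side is written as an inner automorphism, `(p⁻¹)⁻¹`
included, in order to match the definition of `Ad`. -/
lemma inv_expProd_mul_expProd (x : Fin n → ℝ) (k : Fin n) (t : ℝ) :
    (expProd e x)⁻¹ * expProd e (x + t • Pi.single k (1 : ℝ)) =
      (expProdTake e x k)⁻¹ * lieExp (t • e k) * ((expProdTake e x k)⁻¹)⁻¹ := by
  have h0 := expProd_add_smul_single e x k 0
  rw [zero_smul, add_zero, zero_smul, lieExp_zero] at h0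
  rw [expProd_add_smul_single, h0]
  group

lemma AdMatrix_expProd (x : Fin n → ℝ) :
    AdMatrix e (expProd e x) =
      (List.ofFn fun j : Fin n => NormedSpace.exp (x j • adMatrix e j)).reverse.prod := by
  rw [expProd, AdMatrix_list_prod, List.map_reverse, List.map_ofFn]
  simp only [Function.comp_def, AdMatrix_lieExp_smul]

lemma AdMatrix_inv_expProdTake (x : Fin n → ℝ) (k : ℕ) :
    AdMatrix e (expProdTake e x k)⁻¹ =
      ((List.ofFn fun j : Fin n => NormedSpace.exp (-(x j • adMatrix e j))).take k).prod := by
  rw [expProdTake, List.prod_inv_reverse, List.map_reverse, List.reverse_reverse,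
    AdMatrix_list_prod, List.map_take, List.map_take, List.map_ofFn, List.map_ofFn]
  simp only [Function.comp_def, ← lieExp_neg_smul, ← neg_smul, AdMatrix_lieExp_smul]

/-! ### Components in second canonical coordinates -/

variable {e} {ψ : OpenPartialHomeomorph G (Fin n → ℝ)} {x : Fin n → ℝ}

lemma IsSecondCanonical.mdifferentiableAt (hψ : IsSecondCanonical e ψ) {g : G}
    (hg : g ∈ ψ.source) : MDifferentiableAt 𝓘(ℝ, E) 𝓘(ℝ, Fin n → ℝ) ψ g :=
  (hψ.contMDiffOn.contMDiffAt (ψ.open_source.mem_nhds hg)).mdifferentiableAt (by simp)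

lemma IsSecondCanonical.mdifferentiableAt_symm (hψ : IsSecondCanonical e ψ)
    (hx : x ∈ ψ.target) : MDifferentiableAt 𝓘(ℝ, Fin n → ℝ) 𝓘(ℝ, E) ψ.symm x :=
  (hψ.contMDiffOn_symm.contMDiffAt (ψ.open_target.mem_nhds hx)).mdifferentiableAt (by simp)

/-- The left logarithmic derivative of `x ↦ g_x` along `∂_{x^k}`. -/
lemma IsSecondCanonical.mfderiv_inv_mul_coordVector (hψ : IsSecondCanonical e ψ)
    (hx : x ∈ ψ.target) (k : Fin n) :
    (mfderiv 𝓘(ℝ, E) 𝓘(ℝ, E) (fun b : G => (ψ.symm x)⁻¹ * b) (ψ.symm x) (coordVector ψ x k) : E) =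
      Ad (expProdTake e x k)⁻¹ (e k) := by
  set c : ℝ → Fin n → ℝ := fun t => x + t • Pi.single k (1 : ℝ) with hc_def
  have hc0 : c 0 = x := by simp [hc_def]
  have hc : HasDerivAt c (Pi.single k (1 : ℝ)) 0 := by
    have h := ((hasDerivAt_id (0 : ℝ)).smul_const (Pi.single k (1 : ℝ) : Fin n → ℝ)).const_add x
    rwa [one_smul] at h
  have hcM : HasMFDerivAt 𝓘(ℝ, ℝ) 𝓘(ℝ, Fin n → ℝ) c 0
      ((1 : ℝ →L[ℝ] ℝ).smulRight (Pi.single k (1 : ℝ) : Fin n → ℝ)) :=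
    hc.hasFDerivAt.hasMFDerivAt
  have hs : HasMFDerivAt 𝓘(ℝ, Fin n → ℝ) 𝓘(ℝ, E) ψ.symm (c 0)
      (mfderiv 𝓘(ℝ, Fin n → ℝ) 𝓘(ℝ, E) ψ.symm (c 0)) := by
    rw [hc0]; exact (hψ.mdifferentiableAt_symm hx).hasMFDerivAt
  have hl := ((mdifferentiableAt_mul_left (E := E) (ψ.symm x)⁻¹ (ψ.symm (c 0))).hasMFDerivAt.comp
    (c 0) hs).comp (0 : ℝ) hcM
  have hr := (mdifferentiableAt_conj (E := E) (expProdTake e x k)⁻¹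
    (lieExp ((0 : ℝ) • e k))).hasMFDerivAt.comp (0 : ℝ) (hasMFDerivAt_lieExp_zero (e k))
  have heq : ((fun b : G => (ψ.symm x)⁻¹ * b) ∘ ψ.symm) ∘ c =ᶠ[nhds 0]
      (fun b : G => (expProdTake e x k)⁻¹ * b * ((expProdTake e x k)⁻¹)⁻¹) ∘
        fun t : ℝ => lieExp (t • e k) := by
    have hct : ∀ᶠ t in nhds (0 : ℝ), c t ∈ ψ.target :=
      hc.continuousAt.eventually_mem (by rw [hc0]; exact ψ.open_target.mem_nhds hx)
    filter_upwards [hct] with t ht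
    simp only [Function.comp]
    rw [hψ.symm_apply _ ht, hψ.symm_apply _ hx]
    exact inv_expProd_mul_expProd e x k t
  have key := congrArg (fun L : ℝ →L[ℝ] E => L 1)
    (hasMFDerivAt_unique hl (hr.congr_of_eventuallyEq heq))
  -- The two sides of `key` live at the points `c 0` and `exp (0 e_k)`, which have to be replaced by
  -- `x` and `1` uniformly in the dependent tangent spaces.
  have hlv : ∀ y : Fin n → ℝ, y = x →
      (mfderiv 𝓘(ℝ, E) 𝓘(ℝ, E) (fun b : G => (ψ.symm x)⁻¹ * b) (ψ.symm y)
        (mfderiv 𝓘(ℝ, Fin n → ℝ) 𝓘(ℝ, E) ψ.symm y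
          ((1 : ℝ) • Pi.single k (1 : ℝ) : Fin n → ℝ)) : E) =
      mfderiv 𝓘(ℝ, E) 𝓘(ℝ, E) (fun b : G => (ψ.symm x)⁻¹ * b) (ψ.symm x) (coordVector ψ x k) := by
    rintro y rfl
    rw [one_smul]; rfl
  have hrv : ∀ g : G, g = 1 → ∀ v : E,
      (mfderiv 𝓘(ℝ, E) 𝓘(ℝ, E)
        (fun b : G => (expProdTake e x k)⁻¹ * b * ((expProdTake e x k)⁻¹)⁻¹) g
          ((1 : ℝ) • v : E) : E) = Ad (expProdTake e x k)⁻¹ v := by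
    rintro g rfl v
    rw [one_smul]; rfl
  refine (hlv _ hc0).symm.trans (Eq.trans ?_
    (hrv (lieExp ((0 : ℝ) • e k)) (by rw [zero_smul, lieExp_zero]) (e k)))
  exact key

lemma IsSecondCanonical.omega_apply (hψ : IsSecondCanonical e ψ) (hx : x ∈ ψ.target)
    (i k : Fin n) : omega e ψ x i k = AdMatrix e (expProdTake e x k)⁻¹ i k := by
  have h : omega e ψ x i k = e.coord i (Ad (expProdTake e x k)⁻¹ (e k)) :=
    congrArg (e.coord i) (hψ.mfderiv_inv_mul_coordVector hx k)
  rw [h, AdMatrix, LinearMap.toMatrix_apply, Module.Basis.coord_apply]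

omit [FiniteDimensional ℝ E] in
lemma sigma_eq_neg_AdMatrix_mul_omega :
    sigma e ψ x = -(AdMatrix e (ψ.symm x) * omega e ψ x) := by
  ext i k
  rw [Matrix.neg_apply, Matrix.mul_apply]
  exact rightForm_eq_neg_sum e (ψ.symm x) i (coordVector ψ x k)

/-- Contracting the components of a 1-form and of a vector in the coordinates `ψ` evaluates the
form on the vector. -/
lemma IsSecondCanonical.sum_coordVector_mul (hψ : IsSecondCanonical e ψ) (hx : x ∈ ψ.target)
    (θ : TangentSpace 𝓘(ℝ, E) (ψ.symm x) →ₗ[ℝ] ℝ) (v : TangentSpace 𝓘(ℝ, E) (ψ.symm x)) :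
    ∑ k, θ (coordVector ψ x k) *
      (mfderiv 𝓘(ℝ, E) 𝓘(ℝ, Fin n → ℝ) ψ (ψ.symm x) v : Fin n → ℝ) k = θ v := by
  set w : Fin n → ℝ := mfderiv 𝓘(ℝ, E) 𝓘(ℝ, Fin n → ℝ) ψ (ψ.symm x) v with hw
  have hs : MDifferentiableAt 𝓘(ℝ, Fin n → ℝ) 𝓘(ℝ, E) ψ.symm (ψ (ψ.symm x)) := by
    rw [ψ.right_inv hx]; exact hψ.mdifferentiableAt_symm hx
  have h1 := mfderiv_comp_apply (I' := 𝓘(ℝ, Fin n → ℝ)) (ψ.symm x) hs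
    (hψ.mdifferentiableAt (ψ.map_target hx)) v
  have h2 : ψ.symm ∘ ψ =ᶠ[nhds (ψ.symm x)] id :=
    ψ.eventually_left_inverse (ψ.map_target hx)
  rw [h2.mfderiv_eq, mfderiv_id, ψ.right_inv hx] at h1
  have h3 : (mfderiv 𝓘(ℝ, Fin n → ℝ) 𝓘(ℝ, E) ψ.symm x : (Fin n → ℝ) →L[ℝ] E) w = v := h1.symm
  let θ' : E →ₗ[ℝ] ℝ := θ
  have h4 : θ' ((mfderiv 𝓘(ℝ, Fin n → ℝ) 𝓘(ℝ, E) ψ.symm x : (Fin n → ℝ) →L[ℝ] E) w) =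
      θ v := congrArg θ' h3
  rw [← h4]
  let T : (Fin n → ℝ) →ₗ[ℝ] ℝ := θ' ∘ₗ
    (mfderiv 𝓘(ℝ, Fin n → ℝ) 𝓘(ℝ, E) ψ.symm x : (Fin n → ℝ) →L[ℝ] E).toLinearMap
  have h5 : T w = ∑ k, w k * T (Pi.single k 1) := by
    have := T.pi_apply_eq_sum_univ w
    simp only [smul_eq_mul] at this
    rw [this]
    refine Finset.sum_congr rfl fun k _ => ?_
    congr 2
    ext j; simp [Pi.single_apply, eq_comm]
  refine Eq.trans ?_ h5.symm
  exact Finset.sum_congr rfl fun k _ => mul_comm _ _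

lemma IsSecondCanonical.omega_mul_xi (hψ : IsSecondCanonical e ψ) (hx : x ∈ ψ.target) :
    omega e ψ x * xi e ψ x = 1 := by
  ext i j
  rw [Matrix.mul_apply, Matrix.one_apply, ← leftForm_leftField e (ψ.symm x) i j]
  exact hψ.sum_coordVector_mul hx (leftForm e i (ψ.symm x)) (leftField e j (ψ.symm x))

lemma IsSecondCanonical.sigma_mul_eta (hψ : IsSecondCanonical e ψ) (hx : x ∈ ψ.target) :
    sigma e ψ x * eta e ψ x = 1 := by
  ext i j
  rw [Matrix.mul_apply, Matrix.one_apply, ← rightForm_rightField e (ψ.symm x) i j]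
  exact hψ.sum_coordVector_mul hx (rightForm e i (ψ.symm x)) (rightField e j (ψ.symm x))

end

end LieGroupCoords

end

open LieGroupCoords in
theorem mainTheorem1 {E : Type*} [NormedAddCommGroup E] [NormedSpace ℝ E]
    [FiniteDimensional ℝ E] {G : Type*} [TopologicalSpace G] [ChartedSpace E G] [Group G]
    [LieGroup 𝓘(ℝ, E) ∞ G] {n : ℕ}
    (e : Module.Basis (Fin n) ℝ (GroupLieAlgebra 𝓘(ℝ, E) G)) :
    -- the invariant 1-forms are the frames dual to the invariant vector fields
    (∀ (g : G) (i j : Fin n),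
      leftForm e i g (leftField e j g) = (if i = j then 1 else 0) ∧
      rightForm e i g (rightField e j g) = (if i = j then 1 else 0)) ∧
    -- the components in second canonical coordinates
    ∀ ψ : OpenPartialHomeomorph G (Fin n → ℝ), IsSecondCanonical e ψ → ∀ x ∈ ψ.target,
      (∀ i k : Fin n, k.val = 0 → omega e ψ x i k = if i = k then 1 else 0) ∧
      (∀ i k : Fin n, 0 < k.val → omega e ψ x i k =
        ((List.ofFn fun j : Fin n =>
          NormedSpace.exp (-(x j • adMatrix e j))).take k.val).prod i k) ∧
      AdMatrix e (ψ.symm x) =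
        (List.ofFn fun j : Fin n => NormedSpace.exp (x j • adMatrix e j)).reverse.prod ∧
      sigma e ψ x = -(AdMatrix e (ψ.symm x) * omega e ψ x) ∧
      IsUnit (omega e ψ x) ∧ xi e ψ x = (omega e ψ x)⁻¹ ∧
      IsUnit (sigma e ψ x) ∧ eta e ψ x = (sigma e ψ x)⁻¹ := by
  refine ⟨fun g i j => ⟨leftForm_leftField e g i j, rightForm_rightField e g i j⟩,
    fun ψ hψ x hx => ⟨fun i k hk => ?_, fun i k _ => ?_, ?_, sigma_eq_neg_AdMatrix_mul_omega,
      .of_mul_eq_one _ (hψ.omega_mul_xi hx), (Matrix.inv_eq_right_inv (hψ.omega_mul_xi hx)).symm,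
      .of_mul_eq_one _ (hψ.sigma_mul_eta hx), (Matrix.inv_eq_right_inv (hψ.sigma_mul_eta hx)).symm⟩⟩
  · rw [hψ.omega_apply hx, AdMatrix_inv_expProdTake, hk, List.take_zero, List.prod_nil,
      Matrix.one_apply]
  · rw [hψ.omega_apply hx, AdMatrix_inv_expProdTake]
  · rw [hψ.symm_apply x hx, AdMatrix_expProd]
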